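/- Let $F_q$ be the field with $q$ elements, let $V=F_q^n$, and let $k\in\{2,\dots,n-3\}$. For $m\ge 1$ let $\mathcal C(n,m)_q$ be the set of all non-degenerate linear $[n,m]_q$ codes, i.e. of the $m$-dimensional subspaces of $V$ contained in no coordinate hyperplane $\{v\in V: v_i=0\}$, and let $\Gamma(n,m)_q$ be the graph on $\mathcal C(n,m)_q$ in which two codes are adjacent when their intersection has dimension $m-1$. For a subspace $U\subseteq V$ let $\langle U]^c_k$ be the set of all $K\in\mathcal C(n,k)_q$ with $K\subseteq U$. A top is a set $\langle U]^c_k$ with $U\in\mathcal C(n,k+1)_q$ that is a maximal clique of $\Gamma(n,k)_q$; the set of all tops is denoted by $\mathcal U(n,k)_q$. Two distinct tops $\langle U]^c_k$ and $\langle U']^c_k$ are adjacent when $U$ and $U'$ are adjacent in $\Gamma(n,k+1)_q$. Let $\mathrm{Aut}(\mathcal U(n,k)_q)$ be the group of all permutations of $\mathcal U(n,k)_q$ that preserve adjacency in both directions, and let $\mathrm{Aut}_L(\mathcal U(n,k)_q)$ be the subgroup of those $g$ that are induced by a linear automorphism $f$ of $V$, i.e. such that for every top $\langle U]^c_k$ with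 $U\in\mathcal C(n,k+1)_q$ one has $f(U)\in\mathcal C(n,k+1)_q$ and $g(\langle U]^c_k)=\langle f(U)]^c_k$. Let $\langle U]^c_k\in\mathcal U(n,k)_q$ with $U\in\mathcal C(n,k+1)_q$, and let $M$ be any generator matrix of $U$ (a $(k+1)\times n$ matrix whose rows form a basis of $U$). Then the orbit of $\langle U]^c_k$ under the action of $\mathrm{Aut}_L(\mathcal U(n,k)_q)$ consists exactly of those tops $\langle U']^c_k\in\mathcal U(n,k)_q$, $U'\in\mathcal C(n,k+1)_q$, for which $U'$ has a generator matrix $M'$ with the same columns as $M$ up to proportionality, i.e. such that for some permutation $\delta$ of $\{1,\dots,n\}$ every column $M'_i$ of $M'$ is a non-zero scalar multiple of the column $M_{\delta(i)}$ of $M$. -/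

import Mathlib

/-- The `i`-th coordinate hyperplane `C_i`, the kernel of the `i`-th coordinate functional. -/
def coordHyperplane (F : Type*) [Field F] (n : ℕ) (i : Fin n) : Submodule F (Fin n → F) :=
  LinearMap.ker (LinearMap.proj i : (Fin n → F) →ₗ[F] F)

/-- `C(n,k)_q`: the non-degenerate linear `[n,k]_q` codes, that is, the `k`-dimensional subspaces
of `F^n` that are contained in no coordinate hyperplane. -/
abbrev NondegCode (F : Type*) [Field F] (n k : ℕ) : Type _ :=
  {K : Submodule F (Fin n → F) //
    Module.finrank F K = k ∧ ∀ i : Fin n, ¬ K ≤ coordHyperplane F n i}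

/-- The graph `Γ(n,k)_q`: two non-degenerate codes are adjacent when their intersection has
dimension `k - 1`. -/
def codeGraph (F : Type*) [Field F] (n k : ℕ) : SimpleGraph (NondegCode F n k) where
  Adj K L := Module.finrank F (K.1 ⊓ L.1 : Submodule F (Fin n → F)) + 1 = k
  symm := ⟨fun K L h => by rw [inf_comm]; exact h⟩
  loopless := ⟨fun K h => by
    have h2 := K.2.1
    rw [inf_idem] at h
    omega⟩

/-- `⟨U]^c_k`: the non-degenerate `k`-dimensional codes contained in `U`. -/
def codesBelow {F : Type*} [Field F] {n : ℕ} (k : ℕ) (U : Submodule F (Fin n → F)) :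
    Set (NondegCode F n k) :=
  {K | K.1 ≤ U}

/-- `U(n,k)_q`: the set of tops of `Γ(n,k)_q`, that is, of those sets `⟨U]^c_k` with
`U ∈ C(n,k+1)_q` that are maximal cliques of `Γ(n,k)_q`. -/
abbrev CodeTop (F : Type*) [Field F] (n k : ℕ) : Type _ :=
  {T : Set (NondegCode F n k) //
    (∃ U : NondegCode F n (k + 1), T = codesBelow k U.1) ∧ Maximal (codeGraph F n k).IsClique T}

/-- The adjacency of tops: `⟨U]^c_k` and `⟨U']^c_k` are adjacent when `U` and `U'` are adjacent
in `Γ(n,k+1)_q`. -/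
def topGraph (F : Type*) [Field F] (n k : ℕ) : SimpleGraph (CodeTop F n k) where
  Adj T T' := T ≠ T' ∧ ∃ U U' : NondegCode F n (k + 1),
    T.1 = codesBelow k U.1 ∧ T'.1 = codesBelow k U'.1 ∧ (codeGraph F n (k + 1)).Adj U U'
  symm := ⟨fun _ _ h => by
    obtain ⟨hne, U, U', hU, hU', hadj⟩ := h
    exact ⟨hne.symm, U', U, hU', hU, hadj.symm⟩⟩
  loopless := ⟨fun _ h => h.1 rfl⟩

/-- `Aut(U(n,k)_q)`: the permutations of the set of tops that preserve adjacency in both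
directions. -/
abbrev AutTops (F : Type*) [Field F] (n k : ℕ) : Type _ :=
  topGraph F n k ≃g topGraph F n k

/-- The automorphism `g` of the set of tops is induced by the linear automorphism `f` of `F^n`:
for every top `⟨U]^c_k` the subspace `f(U)` is again a non-degenerate code, and `g` maps `⟨U]^c_k`
to `⟨f(U)]^c_k`. -/
def IsInducedBy {F : Type*} [Field F] {n k : ℕ} (g : AutTops F n k)
    (f : (Fin n → F) ≃ₗ[F] (Fin n → F)) : Prop :=
  ∀ (T : CodeTop F n k) (U : NondegCode F n (k + 1)), T.1 = codesBelow k U.1 →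
    ∃ U' : NondegCode F n (k + 1),
      U'.1 = U.1.map (f : (Fin n → F) →ₗ[F] (Fin n → F)) ∧ (g T).1 = codesBelow k U'.1

theorem IsInducedBy.one {F : Type*} [Field F] {n k : ℕ} :
    IsInducedBy (1 : AutTops F n k) (LinearEquiv.refl F (Fin n → F)) := by
  intro T U hU
  refine ⟨U, ?_, hU⟩
  ext x
  simp

theorem IsInducedBy.mul {F : Type*} [Field F] {n k : ℕ} {g h : AutTops F n k}
    {f e : (Fin n → F) ≃ₗ[F] (Fin n → F)} (hg : IsInducedBy g f) (hh : IsInducedBy h e) :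
    IsInducedBy (g * h) (e.trans f) := by
  intro T U hU
  obtain ⟨U₁, hU₁, hT₁⟩ := hh T U hU
  obtain ⟨U₂, hU₂, hT₂⟩ := hg (h T) U₁ hT₁
  refine ⟨U₂, ?_, hT₂⟩
  rw [hU₂, hU₁, LinearEquiv.coe_trans, Submodule.map_comp]

theorem IsInducedBy.pow {F : Type*} [Field F] {n k : ℕ} {g : AutTops F n k}
    {f : (Fin n → F) ≃ₗ[F] (Fin n → F)} (hg : IsInducedBy g f) (m : ℕ) :
    ∃ e : (Fin n → F) ≃ₗ[F] (Fin n → F), IsInducedBy (g ^ m) e := by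
  induction m with
  | zero => exact ⟨_, by rw [pow_zero]; exact IsInducedBy.one⟩
  | succ m ih =>
    obtain ⟨e, he⟩ := ih
    exact ⟨_, by rw [pow_succ]; exact he.mul hg⟩

instance AutTops.finite (F : Type*) [Field F] [Finite F] (n k : ℕ) : Finite (AutTops F n k) :=
  Finite.of_injective (fun g : AutTops F n k => g.toEquiv) RelIso.toEquiv_injective

/-- `Aut_L(U(n,k)_q)`: the group of those automorphisms of the set of tops that are induced by
linear automorphisms of `F^n`. -/
def linearAutTops (F : Type*) [Field F] [Finite F] (n k : ℕ) : Subgroup (AutTops F n k) where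
  carrier := {g | ∃ f : (Fin n → F) ≃ₗ[F] (Fin n → F), IsInducedBy g f}
  one_mem' := ⟨_, IsInducedBy.one⟩
  mul_mem' := by
    rintro g h ⟨f, hf⟩ ⟨e, he⟩
    exact ⟨_, hf.mul he⟩
  inv_mem' := by
    rintro g ⟨f, hf⟩
    obtain ⟨e, he⟩ := hf.pow (Nat.card (AutTops F n k) - 1)
    refine ⟨e, ?_⟩
    have h1 : g⁻¹ = g ^ (Nat.card (AutTops F n k) - 1) := by
      rw [inv_eq_iff_mul_eq_one, ← pow_succ', Nat.sub_add_cancel Nat.card_pos, pow_card_eq_one']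
    rw [h1]
    exact he

/-- `M` is a generator matrix of `U`: its rows form a basis of `U`. -/
def IsGeneratorMatrix {F : Type*} [Field F] {n m : ℕ} (M : Matrix (Fin m) (Fin n) F)
    (U : Submodule F (Fin n → F)) : Prop :=
  LinearIndependent F M.row ∧ Submodule.span F (Set.range M.row) = U

/-- `M` and `M'` consist of the same columns up to proportionality (and up to the order of the
columns, multiplicities being counted). -/
def SameColumns {F : Type*} [Field F] {n m : ℕ} (M M' : Matrix (Fin m) (Fin n) F) : Prop :=
  ∃ δ : Equiv.Perm (Fin n), ∀ i : Fin n, ∃ c : F, c ≠ 0 ∧ M'.col i = c • M.col (δ i)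

/-! The heart is that a linear automorphism `f` inducing an automorphism of the tops is monomial
(`IsInducedBy.monomial`). Suppose the `i`-th coordinate of `f` is a functional `φ` with two non-zero
coefficients. If the hyperplane `φ = 0` contains a code `U` defining a top, then `f(U)` lies in the
`i`-th coordinate hyperplane and is degenerate, a contradiction. So everything rests on finding such
a `U` (`exists_top_le_of_two_nonzero`), over every field, including the one with two elements. To
certify that `U` defines a top it suffices to exhibit three non-degenerate hyperplanes of `U` with
independent equations (`maximal_codesBelow`); `exists_top_range` writes them down for a suitable
encoder. Conversely, a monomial map permutes the coordinate hyperplanes, so it acts on codes and on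
tops. Applied to the rows of a generator matrix, it permutes and rescales the columns, which is the
stated description of the orbit. -/

open Module in
theorem finrank_inf_of_le_of_ne {F V : Type*} [Field F] [AddCommGroup V] [Module F V]
    [FiniteDimensional F V] {k : ℕ} {K L U : Submodule F V} (hK : finrank F K = k)
    (hL : finrank F L = k) (hU : finrank F U = k + 1) (hKU : K ≤ U) (hLU : L ≤ U) (hne : K ≠ L) :
    finrank F (K ⊓ L : Submodule F V) + 1 = k := by
  have h1 := Submodule.finrank_sup_add_finrank_inf_eq K L
  have h2 : finrank F (K ⊔ L : Submodule F V) ≤ k + 1 := hU ▸ Submodule.finrank_mono (sup_le hKU hLU)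
  have h3 : K < K ⊔ L := by
    refine lt_of_le_of_ne le_sup_left fun h => hne ?_
    have : L ≤ K := by rw [h]; exact le_sup_right
    exact (Submodule.eq_of_le_of_finrank_eq this (by rw [hK, hL])).symm
  have h4 := Submodule.finrank_lt_finrank_of_lt h3
  omega

/-! ### Cliques of codes inside a common code, and a criterion for maximality -/

theorem codesBelow_isClique {F : Type*} [Field F] {n k : ℕ} (U : NondegCode F n (k + 1)) :
    (codeGraph F n k).IsClique (codesBelow k U.1) := by
  intro K hK L hL hne
  exact finrank_inf_of_le_of_ne K.2.1 L.2.1 U.2.1 hK hL (fun h => hne (Subtype.ext h))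

open Module in
/-- If three non-degenerate hyperplanes of `U` are independent, then `⟨U]^c_k` is a top. -/
theorem maximal_codesBelow {F : Type*} [Field F] {n k : ℕ} (U : NondegCode F n (k + 1))
    (K₁ K₂ K₃ : NondegCode F n k) (h₁ : K₁.1 ≤ U.1) (h₂ : K₂.1 ≤ U.1) (h₃ : K₃.1 ≤ U.1)
    {v w : Fin n → F} (hv₁ : v ∈ K₁.1) (hv₂ : v ∉ K₂.1) (hw₁ : w ∈ K₁.1) (hw₂ : w ∈ K₂.1)
    (hw₃ : w ∉ K₃.1) : Maximal (codeGraph F n k).IsClique (codesBelow k U.1) := by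
  refine ⟨codesBelow_isClique U, fun S hS hUS K hK => ?_⟩
  by_contra hKU
  have hlt : K.1 ⊓ U.1 < K.1 := lt_of_le_of_ne inf_le_left fun h => hKU (inf_eq_left.mp h)
  have hlt' := Submodule.finrank_lt_finrank_of_lt hlt
  rw [K.2.1] at hlt'
  -- `K ⊓ K'` has dimension `k - 1` and lies in `K ⊓ U`, of dimension at most `k - 1`. The two
  -- coincide, so `K ⊓ U` lies in every code below `U`.
  have key : ∀ K' : NondegCode F n k, K'.1 ≤ U.1 →
      finrank F (K.1 ⊓ U.1 : Submodule F (Fin n → F)) + 1 = k ∧ K.1 ⊓ U.1 ≤ K'.1 := by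
    intro K' hK'
    have hadj : finrank F (K.1 ⊓ K'.1 : Submodule F (Fin n → F)) + 1 = k :=
      hS hK (hUS hK') (by rintro rfl; exact hKU hK')
    have hle : K.1 ⊓ K'.1 ≤ K.1 ⊓ U.1 := inf_le_inf_left _ hK'
    have hm := Submodule.finrank_mono hle
    have heq := Submodule.eq_of_le_of_finrank_eq hle (by omega)
    exact ⟨by rw [← heq]; exact hadj, heq ▸ inf_le_right⟩
  -- `v` and `w` witness two strict drops, so the triple intersection has dimension at most `k - 2`,
  -- too small to contain `K ⊓ U`.
  have hlt₁ : K₁.1 ⊓ K₂.1 < K₁.1 :=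
    lt_of_le_of_ne inf_le_left fun h => hv₂ (inf_eq_left.mp h hv₁)
  have hlt₂ : K₁.1 ⊓ K₂.1 ⊓ K₃.1 < K₁.1 ⊓ K₂.1 :=
    lt_of_le_of_ne inf_le_left fun h => hw₃ (inf_eq_left.mp h ⟨hw₁, hw₂⟩)
  have hf₁ := Submodule.finrank_lt_finrank_of_lt hlt₁
  have hf₂ := Submodule.finrank_lt_finrank_of_lt hlt₂
  have hf₃ := Submodule.finrank_mono
    (le_inf (le_inf (key K₁ h₁).2 (key K₂ h₂).2) (key K₃ h₃).2)
  have := (key K₁ h₁).1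
  have := K₁.2.1
  omega

/-! ### Codes defining tops inside a given hyperplane -/

open Module in
/-- The image of a hyperplane `ker y` under an injective encoder is a non-degenerate code as soon
as no coordinate of the encoder vanishes on it. -/
def kerCode {F : Type*} [Field F] {n k : ℕ} (L : (Fin (k + 1) → F) →ₗ[F] (Fin n → F))
    (hL : Function.Injective L) (y : Module.Dual F (Fin (k + 1) → F)) (hy : y ≠ 0)
    (h : ∀ i, ∃ x, y x = 0 ∧ L x i ≠ 0) : NondegCode F n k :=
  ⟨(LinearMap.ker y).map L, by
    have h1 := Module.Dual.finrank_ker_add_one_of_ne_zero hy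
    have h2 := LinearEquiv.finrank_eq (Submodule.equivMapOfInjective L hL (LinearMap.ker y))
    rw [Module.finrank_fin_fun] at h1
    omega, fun i hi => by
    obtain ⟨x, hx, hne⟩ := h i
    exact hne (hi (Submodule.mem_map_of_mem (f := L) (show x ∈ LinearMap.ker y from hx)))⟩

/-- The three hyperplanes are the kernels of `x₀ + x₂`, `x₁ + x₂` and `x₀ + x₁ + x₂`, whose
coefficient determinant is `-1`, hence independent in every characteristic. Such a kernel is
degenerate only if some coordinate of `L` is proportional to its equation. A multiple of a single `x
j` is not, since each equation has at least two terms; a coordinate involving `x₀` but not `x₂` is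
not, since each equation involves `x₂`. -/
theorem exists_top_range {F : Type*} [Field F] {n m : ℕ}
    (L : (Fin (m + 3) → F) →ₗ[F] (Fin n → F)) (hL : Function.Injective L)
    (h : ∀ i, (∃ j : Fin (m + 3), ∃ a : F, a ≠ 0 ∧ ∀ x, L x i = a * x j) ∨
      (L (Pi.single 0 1) i ≠ 0 ∧ L (Pi.single 2 1) i = 0 )) :
    ∃ U : NondegCode F n (m + 3), U.1 = LinearMap.range L ∧
      Maximal (codeGraph F n (m + 2)).IsClique (codesBelow (m + 2) U.1) := by
  have h01 : (0 : Fin (m + 3)) ≠ 1 := by simp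
  have h02 : (0 : Fin (m + 3)) ≠ 2 := by
    simp [Fin.ext_iff, Nat.mod_eq_of_lt (show 2 < m + 3 by omega)]
  have h12 : (1 : Fin (m + 3)) ≠ 2 := by
    simp [Fin.ext_iff, Nat.mod_eq_of_lt (show 2 < m + 3 by omega)]
  let p : Fin (m + 3) → Module.Dual F (Fin (m + 3) → F) := fun j => LinearMap.proj j
  let e : Fin (m + 3) → (Fin (m + 3) → F) := fun j => Pi.single j 1
  have pe : ∀ i j, p i (e j) = if i = j then 1 else 0 := fun i j => by
    simp [p, e, Pi.single_apply]
  have nondeg : ∀ y : Module.Dual F (Fin (m + 3) → F),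
      (∀ j, ∃ x, y x = 0 ∧ p j x ≠ 0) → (∃ t : F, y (e 0 - t • e 2) = 0) →
      ∀ i, ∃ x, y x = 0 ∧ L x i ≠ 0 := by
    intro y hy1 hy2 i
    rcases h i with ⟨j, a, ha, hj⟩ | ⟨h0, h2⟩
    · obtain ⟨x, hx, hxj⟩ := hy1 j
      exact ⟨x, hx, by rw [hj]; exact mul_ne_zero ha hxj⟩
    · obtain ⟨t, ht⟩ := hy2
      refine ⟨_, ht, ?_⟩
      simp only [map_sub, map_smul, Pi.sub_apply, Pi.smul_apply]
      rw [show L (e 2) i = 0 from h2]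
      simpa using h0
  have n1 : ∀ i, ∃ x, (p 0 + p 2) x = 0 ∧ L x i ≠ 0 := by
    refine nondeg _ (fun j => ?_) ⟨1, by simp [pe, h02, h02.symm]⟩
    by_cases hj : j = 0 ∨ j = 2
    · refine ⟨e 0 - e 2, by simp [pe, h02, h02.symm], ?_⟩
      rcases hj with rfl | rfl <;> simp [pe, h02, h02.symm]
    · push Not at hj
      exact ⟨e j, by simp [pe, hj.1.symm, hj.2.symm], by simp [pe]⟩
  have n2 : ∀ i, ∃ x, (p 1 + p 2) x = 0 ∧ L x i ≠ 0 := by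
    refine nondeg _ (fun j => ?_) ⟨0, by simp [pe, h02.symm, h01.symm]⟩
    by_cases hj : j = 1 ∨ j = 2
    · refine ⟨e 1 - e 2, by simp [pe, h12, h12.symm], ?_⟩
      rcases hj with rfl | rfl <;> simp [pe, h12, h12.symm]
    · push Not at hj
      exact ⟨e j, by simp [pe, hj.1.symm, hj.2.symm], by simp [pe]⟩
  have n3 : ∀ i, ∃ x, (p 0 + p 1 + p 2) x = 0 ∧ L x i ≠ 0 := by
    refine nondeg _ (fun j => ?_) ⟨1, by simp [pe, h02, h02.symm, h12, h01.symm]⟩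
    by_cases hj : j = 0 ∨ j = 2
    · refine ⟨e 0 - e 2, by simp [pe, h02, h02.symm, h12, h01.symm], ?_⟩
      rcases hj with rfl | rfl <;> simp [pe, h02, h02.symm]
    · push Not at hj
      by_cases hj1 : j = 1
      · subst hj1
        exact ⟨e 1 - e 2, by simp [pe, h02, h12, h12.symm, h01], by simp [pe, h12]⟩
      · exact ⟨e j, by simp [pe, hj.1.symm, hj.2.symm, Ne.symm hj1], by simp [pe]⟩
  have hne : ∀ y : Module.Dual F (Fin (m + 3) → F), ∀ x, y x ≠ 0 → y ≠ 0 := by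
    rintro y x hx rfl
    exact hx rfl
  have hle : ∀ y : Module.Dual F (Fin (m + 3) → F),
      (LinearMap.ker y).map L ≤ LinearMap.range L := fun y => LinearMap.map_le_range
  let K₁ : NondegCode F n (m + 2) :=
    kerCode L hL (p 0 + p 2) (hne _ (e 0) (by simp [pe, h02.symm])) n1
  let K₂ : NondegCode F n (m + 2) :=
    kerCode L hL (p 1 + p 2) (hne _ (e 1) (by simp [pe, h12.symm])) n2
  let K₃ : NondegCode F n (m + 2) :=
    kerCode L hL (p 0 + p 1 + p 2) (hne _ (e 0) (by simp [pe, h02.symm, h01.symm])) n3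
  let U : NondegCode F n (m + 3) := ⟨LinearMap.range L, by
    rw [LinearMap.finrank_range_of_inj hL, Module.finrank_fin_fun],
    fun i hi => K₁.2.2 i ((hle _).trans hi)⟩
  have mem : ∀ (y : Module.Dual F (Fin (m + 3) → F)) (x : Fin (m + 3) → F),
      L x ∈ (LinearMap.ker y).map L ↔ y x = 0 := fun y x => by
    rw [Submodule.mem_map]
    constructor
    · rintro ⟨z, hz, hzx⟩
      rw [← hL hzx]
      exact hz
    · exact fun hx => ⟨x, hx, rfl⟩
  -- `e 1` satisfies the first equation but not the second; `e 0 + e 1 - e 2` satisfies the first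
  -- two, and the third form takes the value `1` on it.
  refine ⟨U, rfl, maximal_codesBelow U K₁ K₂ K₃ (hle _) (hle _) (hle _)
    (v := L (e 1)) (w := L (e 0 + e 1 - e 2)) ((mem _ _).2 ?_) (fun hm => ?_)
    ((mem _ _).2 ?_) ((mem _ _).2 ?_) (fun hm => ?_)⟩
  · simp [pe, h01, h12.symm]
  · simpa [pe, h12.symm] using (mem _ _).1 hm
  · simp [pe, h01, h02, h12.symm, h02.symm]
  · simp [pe, h01.symm, h12, h12.symm, h02.symm]
  · simpa [pe, h01, h01.symm, h02, h12, h12.symm, h02.symm] using (mem _ _).1 hm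

/-- This is where `k + 3 ≤ n` is spent: removing `p`, `q` and at most two elements of `Z` leaves at
least `k - 1` indices, enough to cover the `k - 1` labels other than `j₀` and `j₂`. -/
theorem exists_surjective_fibres {n k : ℕ} (hk : 2 ≤ k) (hkn : k + 3 ≤ n) (p q : Fin n)
    (Z : Finset (Fin n)) (hZ : Z.Nonempty) (hZ2 : Z.card ≤ 2) (hpZ : p ∉ Z) (hqZ : q ∉ Z)
    (hpq : p ≠ q) (j₀ j₂ : Fin (k + 1)) (hj : j₀ ≠ j₂) :
    ∃ c : Fin n → Fin (k + 1), (∀ j, ∃ i, i ≠ p ∧ c i = j) ∧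
      (∀ i, i ≠ p → (c i = j₀ ↔ i = q)) ∧ (∀ i, i ≠ p → (c i = j₂ ↔ i ∈ Z)) := by
  classical
  let R : Finset (Fin n) := (insert p (insert q Z))ᶜ
  let J : Finset (Fin (k + 1)) := ({j₀, j₂} : Finset (Fin (k + 1)))ᶜ
  have hJ : J.card = k - 1 := by
    rw [Finset.card_compl, Finset.card_pair hj, Fintype.card_fin]; omega
  have hR : k - 1 ≤ R.card := by
    have h1 := Finset.card_insert_le p (insert q Z)
    have h2 := Finset.card_insert_le q Z
    rw [Finset.card_compl, Fintype.card_fin]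
    omega
  have hJne : Nonempty J := by
    rw [Finset.nonempty_coe_sort, ← Finset.card_pos]; omega
  obtain ⟨ι⟩ : Nonempty (J ↪ R) := Function.Embedding.nonempty_of_card_le (by simp; omega)
  let g : R → J := Function.invFun ι
  have hg : Function.Surjective g := Function.invFun_surjective ι.injective
  -- The final `j₀` is reached only at `i = p`, where the value of `c` is immaterial.
  let c : Fin n → Fin (k + 1) := fun i =>
    if i = q then j₀ else if i ∈ Z then j₂ else if h : i ∈ R then g ⟨i, h⟩ else j₀
  have hcq : c q = j₀ := by simp [c]
  have hcZ : ∀ i ∈ Z, c i = j₂ := fun i hi => by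
    have : i ≠ q := by rintro rfl; exact hqZ hi
    simp [c, this, hi]
  have hcR : ∀ (i) (h : i ∈ R), c i = g ⟨i, h⟩ := fun i h => by
    have h' : i ≠ p ∧ i ≠ q ∧ i ∉ Z := by simpa [R] using h
    simp only [c, if_neg h'.2.1, if_neg h'.2.2, dif_pos h]
  have hgJ : ∀ x, (g x : Fin (k + 1)) ≠ j₀ ∧ (g x : Fin (k + 1)) ≠ j₂ := fun x => by
    simpa [J] using (g x).2
  have cases : ∀ i, i ≠ p → i = q ∨ i ∈ Z ∨ i ∈ R := fun i hi => by
    by_cases h1 : i = q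
    · exact Or.inl h1
    by_cases h2 : i ∈ Z
    · exact Or.inr (Or.inl h2)
    · exact Or.inr (Or.inr (by simp [R, hi, h1, h2]))
  have hRn : ∀ i ∈ R, i ≠ p ∧ i ≠ q ∧ i ∉ Z := fun i h => by simpa [R] using h
  refine ⟨c, fun j => ?_, fun i hi => ⟨fun h => ?_, ?_⟩, fun i hi => ⟨fun h => ?_, hcZ i⟩⟩
  · by_cases h0 : j = j₀
    · exact ⟨q, hpq.symm, by rw [hcq, h0]⟩
    by_cases h2 : j = j₂
    · obtain ⟨z, hz⟩ := hZ
      exact ⟨z, by rintro rfl; exact hpZ hz, by rw [hcZ z hz, h2]⟩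
    · obtain ⟨⟨i, hi⟩, hgi⟩ := hg ⟨j, by simp [J, h0, h2]⟩
      exact ⟨i, (hRn i hi).1, by rw [hcR i hi, hgi]⟩
  · rcases cases i hi with h1 | h1 | h1
    · exact h1
    · exact absurd ((hcZ i h1).symm.trans h) hj.symm
    · exact absurd ((hcR i h1).symm.trans h) (hgJ _).1
  · rintro rfl; exact hcq
  · rcases cases i hi with h1 | h1 | h1
    · subst h1; exact absurd (hcq.symm.trans h) hj
    · exact h1
    · exact absurd ((hcR i h1).symm.trans h) (hgJ _).2

/-- `Z` is a single zero of `φ` if there is one. Otherwise it is any two indices outside `{p, q}`,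
scaled so that their terms are `1` and `-1`. -/
theorem exists_scaled_zero_sum {F : Type*} [Field F] {n : ℕ} (hn : 5 ≤ n) (φ : Fin n → F)
    {p q : Fin n} (hp : φ p ≠ 0) (hq : φ q ≠ 0) :
    ∃ (Z : Finset (Fin n)) (a : Fin n → F), Z.Nonempty ∧ Z.card ≤ 2 ∧ p ∉ Z ∧ q ∉ Z ∧
      (∀ i, a i ≠ 0) ∧ ∑ i ∈ Z, φ i * a i = 0 := by
  classical
  by_cases h : ∃ z, φ z = 0
  · obtain ⟨z, hz⟩ := h
    refine ⟨{z}, fun _ => 1, by simp, by simp, ?_, ?_, by simp, by simp [hz]⟩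
    · rw [Finset.mem_singleton]; rintro rfl; exact hp hz
    · rw [Finset.mem_singleton]; rintro rfl; exact hq hz
  · push Not at h
    obtain ⟨Z, hZ, hZc⟩ := Finset.exists_subset_card_eq
      (s := ({p, q} : Finset (Fin n))ᶜ) (n := 2) (by
        have := Finset.card_le_two (a := p) (b := q)
        rw [Finset.card_compl, Fintype.card_fin]; omega)
    obtain ⟨x, y, hxy, rfl⟩ := Finset.card_eq_two.mp hZc
    have hmem : ∀ i ∈ ({x, y} : Finset (Fin n)), i ≠ p ∧ i ≠ q := fun i hi => by
      simpa using hZ hi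
    refine ⟨{x, y}, fun i => if i = x then (φ i)⁻¹ else -(φ i)⁻¹, by simp, hZc.le,
      fun hm => (hmem _ hm).1 rfl, fun hm => (hmem _ hm).2 rfl, fun i => ?_, ?_⟩
    · dsimp only
      split_ifs <;> simp [h i]
    · rw [Finset.sum_pair hxy]
      simp [hxy.symm, h x, h y]

/-- A hyperplane whose equation involves two coordinates contains a code defining a top. -/
theorem exists_top_le_of_two_nonzero {F : Type*} [Field F] {n k : ℕ} (hk : 2 ≤ k)
    (hkn : k + 3 ≤ n) (φ : Fin n → F) {p q : Fin n} (hpq : p ≠ q) (hp : φ p ≠ 0) (hq : φ q ≠ 0) :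
    ∃ U : NondegCode F n (k + 1), Maximal (codeGraph F n k).IsClique (codesBelow k U.1) ∧
      ∀ v ∈ U.1, ∑ i, φ i * v i = 0 := by
  classical
  obtain ⟨m, rfl⟩ : ∃ m, k = m + 2 := ⟨k - 2, by omega⟩
  obtain ⟨Z, a, hZ, hZ2, hpZ, hqZ, ha, hsum⟩ :=
    exists_scaled_zero_sum (by omega) φ hp hq
  have h02 : (0 : Fin (m + 3)) ≠ 2 := by
    simp [Fin.ext_iff, Nat.mod_eq_of_lt (show 2 < m + 3 by omega)]
  obtain ⟨c, hc, hc0, hc2⟩ :=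
    exists_surjective_fibres hk hkn p q Z hZ hZ2 hpZ hqZ hpq (0 : Fin (m + 3)) 2 h02
  let s : (Fin (m + 3) → F) →ₗ[F] F :=
    ∑ i ∈ Finset.univ.erase p, (φ i * a i) • (LinearMap.proj (c i) : (Fin (m + 3) → F) →ₗ[F] F)
  have hs : ∀ x, s x = ∑ i ∈ Finset.univ.erase p, φ i * a i * x (c i) := fun x => by simp [s]
  -- Away from `p` each coordinate is a scaled repetition of a variable; coordinate `p` is then
  -- solved from the equation `φ = 0`.
  let L : (Fin (m + 3) → F) →ₗ[F] (Fin n → F) := LinearMap.pi fun i =>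
    if i = p then (-(φ p)⁻¹) • s else a i • LinearMap.proj (c i)
  have hLp : ∀ x, L x p = -(φ p)⁻¹ * s x := fun x => by simp [L]
  have hLi : ∀ i, i ≠ p → ∀ x, L x i = a i * x (c i) := fun i hi x => by simp [L, hi]
  have hL : Function.Injective L := by
    intro x y hxy
    ext j
    obtain ⟨i, hi, rfl⟩ := hc j
    have := congrFun hxy i
    rw [hLi i hi, hLi i hi] at this
    exact mul_left_cancel₀ (ha i) this
  obtain ⟨U, hU, hmax⟩ := exists_top_range L hL fun i => by
    by_cases hi : i = p
    · subst hi
      right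
      rw [hLp, hLp, hs, hs]
      constructor
      -- Only `q` carries the variable `x₀`, so its coefficient in `s` is `φ q * a q`.
      · refine mul_ne_zero (neg_ne_zero.mpr (inv_ne_zero hp)) ?_
        rw [Finset.sum_eq_single q]
        · rw [(hc0 q hpq.symm).2 rfl]
          simpa using ⟨hq, ha q⟩
        · intro i hi hiq
          have : c i ≠ 0 := fun h => hiq ((hc0 i (Finset.ne_of_mem_erase hi)).1 h)
          simp [this]
        · intro h
          exact absurd (Finset.mem_erase.2 ⟨hpq.symm, Finset.mem_univ q⟩) h
      -- The indices carrying `x₂` are those of `Z`, and their contributions cancel by `hsum`.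
      · rw [← Finset.sum_subset (s₁ := Z)]
        · rw [Finset.sum_congr rfl (g := fun i => φ i * a i), hsum, mul_zero]
          intro j hj
          have hji : j ≠ i := by rintro rfl; exact hpZ hj
          rw [(hc2 j hji).2 hj]
          simp
        · intro j hj
          have hji : j ≠ i := by rintro rfl; exact hpZ hj
          exact Finset.mem_erase.2 ⟨hji, Finset.mem_univ j⟩
        · intro j hj hjZ
          have : c j ≠ 2 := fun h => hjZ ((hc2 j (Finset.ne_of_mem_erase hj)).1 h)
          simp [this]
    · exact Or.inl ⟨c i, a i, ha i, hLi i hi⟩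
  refine ⟨U, hmax, fun v hv => ?_⟩
  rw [hU] at hv
  obtain ⟨x, rfl⟩ := hv
  rw [← Finset.add_sum_erase _ _ (Finset.mem_univ p), hLp,
    Finset.sum_congr rfl (g := fun i => φ i * a i * x (c i)), ← hs]
  · field_simp
    ring
  · intro i hi
    rw [hLi i (Finset.ne_of_mem_erase hi), mul_assoc]

/-! ### Monomiality of the inducing linear maps -/

/-- A linear automorphism inducing an automorphism of the set of tops is monomial. -/
theorem IsInducedBy.monomial {F : Type*} [Field F] {n k : ℕ} (hk : 2 ≤ k) (hkn : k + 3 ≤ n)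
    {g : AutTops F n k} {f : (Fin n → F) ≃ₗ[F] (Fin n → F)} (hg : IsInducedBy g f) :
    ∃ (δ : Equiv.Perm (Fin n)) (c : Fin n → F), (∀ i, c i ≠ 0) ∧
      ∀ v i, f v i = c i * v (δ i) := by
  classical
  let A : Fin n → Fin n → F := fun i j => f (Pi.single j 1) i
  have hA : ∀ v i, f v i = ∑ j, A i j * v j := fun v i => by
    conv_lhs => rw [pi_eq_sum_univ' v]
    simp [A, mul_comm]
  -- Two non-zero entries in row `i` would give a top whose code `f` sends into the `i`-th
  -- coordinate hyperplane.
  have hz : ∀ i p q, p ≠ q → A i p ≠ 0 → A i q = 0 := by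
    intro i p q hpq hp
    by_contra hq
    obtain ⟨U, hmax, hU⟩ := exists_top_le_of_two_nonzero hk hkn (A i) hpq hp hq
    obtain ⟨U', hU', -⟩ := hg ⟨codesBelow k U.1, ⟨U, rfl⟩, hmax⟩ U rfl
    refine U'.2.2 i ?_
    rw [hU']
    rintro _ ⟨v, hv, rfl⟩
    exact (hA v i).trans (hU v hv)
  have hex : ∀ i, ∃ j, A i j ≠ 0 := by
    intro i
    by_contra! h
    obtain ⟨v, hv⟩ := f.surjective (Pi.single i 1)
    have := hA v i
    simp [hv, h] at this
  choose δ hδ using hex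
  have hf : ∀ v i, f v i = A i (δ i) * v (δ i) := fun v i => by
    rw [hA, Finset.sum_eq_single (δ i)]
    · intro j _ hj
      rw [hz i (δ i) j hj.symm (hδ i), zero_mul]
    · simp
  -- An index missed by `δ` would give a zero column of `A`, contradicting the injectivity of `f`.
  have hsurj : Function.Surjective δ := by
    intro j
    by_contra! h
    have : f (Pi.single j 1) = 0 := by
      ext i
      rw [hf]
      simp [h i]
    have := congrFun (f.map_eq_zero_iff.mp this) j
    simp at this
  exact ⟨Equiv.ofBijective δ (Finite.injective_iff_bijective.1
    (Finite.injective_iff_surjective.2 hsurj)), fun i => A i (δ i), hδ, hf⟩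

/-! ### Action of monomial maps on codes and tops -/

theorem exists_monomial {F : Type*} [Field F] {n : ℕ} (δ : Equiv.Perm (Fin n)) (c : Fin n → F)
    (hc : ∀ i, c i ≠ 0) :
    ∃ f : (Fin n → F) ≃ₗ[F] (Fin n → F), ∀ v i, f v i = c i * v (δ i) :=
  ⟨(LinearEquiv.funCongrLeft F F δ).trans
    (LinearEquiv.piCongrRight fun i => LinearEquiv.smulOfNeZero F F (c i) (hc i)),
    fun v i => by simp⟩

/-- The preimage under `f` of the `i`-th coordinate hyperplane is the `δ i`-th one, and `δ` is a
bijection. -/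
theorem nondegenerate_map_iff {F : Type*} [Field F] {n : ℕ} {δ : Equiv.Perm (Fin n)}
    {c : Fin n → F} (hc : ∀ i, c i ≠ 0) {f : (Fin n → F) ≃ₗ[F] (Fin n → F)}
    (hf : ∀ v i, f v i = c i * v (δ i)) (K : Submodule F (Fin n → F)) :
    (∀ i, ¬ K ≤ coordHyperplane F n i) ↔
      ∀ i, ¬ K.map (f : (Fin n → F) →ₗ[F] (Fin n → F)) ≤ coordHyperplane F n i := by
  have h : ∀ i, K.map (f : (Fin n → F) →ₗ[F] (Fin n → F)) ≤ coordHyperplane F n i ↔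
      K ≤ coordHyperplane F n (δ i) := fun i => by
    rw [Submodule.map_le_iff_le_comap]
    refine forall₂_congr fun v _ => ?_
    simp [coordHyperplane, hf, hc i]
  simp only [h]
  exact δ.forall_congr_right.symm

/-- The permutation of the non-degenerate codes given by a linear automorphism that preserves
non-degeneracy. -/
def codeMap {F : Type*} [Field F] {n : ℕ} (f : (Fin n → F) ≃ₗ[F] (Fin n → F))
    (hf : ∀ K : Submodule F (Fin n → F), (∀ i, ¬ K ≤ coordHyperplane F n i) ↔
      ∀ i, ¬ K.map (f : (Fin n → F) →ₗ[F] (Fin n → F)) ≤ coordHyperplane F n i) (k : ℕ) :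
    codeGraph F n k ≃g codeGraph F n k where
  toEquiv := (Submodule.orderIsoMapComap f).toEquiv.subtypeEquiv fun K =>
    and_congr (by
      show _ ↔ Module.finrank F (K.map (f : (Fin n → F) →ₗ[F] (Fin n → F))) = k
      rw [LinearEquiv.finrank_map_eq]) (hf K)
  map_rel_iff' := by
    intro K L
    show Module.finrank F (K.1.map (f : (Fin n → F) →ₗ[F] (Fin n → F)) ⊓
      L.1.map (f : (Fin n → F) →ₗ[F] (Fin n → F)) : Submodule F (Fin n → F)) + 1 = k ↔ _
    rw [← Submodule.map_inf _ f.injective, LinearEquiv.finrank_map_eq]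
    rfl

theorem codeMap_coe {F : Type*} [Field F] {n : ℕ} (f : (Fin n → F) ≃ₗ[F] (Fin n → F))
    (hf : ∀ K : Submodule F (Fin n → F), (∀ i, ¬ K ≤ coordHyperplane F n i) ↔
      ∀ i, ¬ K.map (f : (Fin n → F) →ₗ[F] (Fin n → F)) ≤ coordHyperplane F n i) (k : ℕ)
    (K : NondegCode F n k) :
    (codeMap f hf k K).1 = K.1.map (f : (Fin n → F) →ₗ[F] (Fin n → F)) := rfl

theorem image_codesBelow {F : Type*} [Field F] {n k : ℕ} (f : (Fin n → F) ≃ₗ[F] (Fin n → F))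
    (hf : ∀ K : Submodule F (Fin n → F), (∀ i, ¬ K ≤ coordHyperplane F n i) ↔
      ∀ i, ¬ K.map (f : (Fin n → F) →ₗ[F] (Fin n → F)) ≤ coordHyperplane F n i)
    (U : NondegCode F n (k + 1)) :
    codeMap f hf k '' codesBelow k U.1 = codesBelow k (codeMap f hf (k + 1) U).1 := by
  ext K
  obtain ⟨K, rfl⟩ := (codeMap f hf k).surjective K
  rw [(codeMap f hf k).injective.mem_set_image]
  show K.1 ≤ U.1 ↔ K.1.map (f : (Fin n → F) →ₗ[F] (Fin n → F)) ≤ U.1.map _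
  rw [Submodule.map_le_map_iff_of_injective f.injective]

theorem SimpleGraph.Iso.maximal_isClique_image {V : Type*} {G : SimpleGraph V} (e : G ≃g G)
    {T : Set V} (hT : Maximal G.IsClique T) : Maximal G.IsClique (e '' T) := by
  have him : ∀ (e : G ≃g G) {S : Set V}, G.IsClique S → G.IsClique (e '' S) := by
    rintro e S hS _ ⟨x, hx, rfl⟩ _ ⟨y, hy, rfl⟩ hne
    exact e.map_adj_iff.2 (hS hx hy fun h => hne (by rw [h]))
  refine ⟨him e hT.1, fun S hS hle x hx => ⟨e.symm x, hT.2 (him e.symm hS) ?_ ⟨x, hx, rfl⟩, ?_⟩⟩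
  · exact fun y hy => ⟨e y, hle ⟨y, hy, rfl⟩, e.symm_apply_apply y⟩
  · exact e.apply_symm_apply x

/-- The automorphism of the set of tops given by a linear automorphism that preserves
non-degeneracy. -/
def topMap {F : Type*} [Field F] {n : ℕ} (f : (Fin n → F) ≃ₗ[F] (Fin n → F))
    (hf : ∀ K : Submodule F (Fin n → F), (∀ i, ¬ K ≤ coordHyperplane F n i) ↔
      ∀ i, ¬ K.map (f : (Fin n → F) →ₗ[F] (Fin n → F)) ≤ coordHyperplane F n i) (k : ℕ) :
    AutTops F n k where
  toEquiv := (Equiv.Set.congr (codeMap f hf k).toEquiv).subtypeEquiv fun T => by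
    show _ ↔ (∃ U : NondegCode F n (k + 1), codeMap f hf k '' T = codesBelow k U.1) ∧
      Maximal (codeGraph F n k).IsClique (codeMap f hf k '' T)
    refine and_congr ?_ ⟨(codeMap f hf k).maximal_isClique_image, fun h => ?_⟩
    · refine Iff.trans (exists_congr fun U => ?_) (codeMap f hf (k + 1)).surjective.exists.symm
      rw [← image_codesBelow f hf U, (codeMap f hf k).injective.image_injective.eq_iff]
    · have := (codeMap f hf k).symm.maximal_isClique_image h
      rw [← Set.image_comp] at this
      convert this
      ext x
      simp
  map_rel_iff' := by
    intro T T'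
    refine and_congr (EquivLike.injective _).ne_iff ?_
    show (∃ U U' : NondegCode F n (k + 1), codeMap f hf k '' T.1 = codesBelow k U.1 ∧
      codeMap f hf k '' T'.1 = codesBelow k U'.1 ∧ _) ↔ _
    refine (codeMap f hf (k + 1)).surjective.exists.trans (exists_congr fun U => ?_)
    refine (codeMap f hf (k + 1)).surjective.exists.trans (exists_congr fun U' => ?_)
    rw [← image_codesBelow, ← image_codesBelow,
      (codeMap f hf k).injective.image_injective.eq_iff,
      (codeMap f hf k).injective.image_injective.eq_iff, (codeMap f hf (k + 1)).map_adj_iff]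

theorem topMap_coe {F : Type*} [Field F] {n : ℕ} (f : (Fin n → F) ≃ₗ[F] (Fin n → F))
    (hf : ∀ K : Submodule F (Fin n → F), (∀ i, ¬ K ≤ coordHyperplane F n i) ↔
      ∀ i, ¬ K.map (f : (Fin n → F) →ₗ[F] (Fin n → F)) ≤ coordHyperplane F n i) (k : ℕ)
    (T : CodeTop F n k) : (topMap f hf k T).1 = codeMap f hf k '' T.1 := rfl

theorem topMap_isInducedBy {F : Type*} [Field F] {n : ℕ} (f : (Fin n → F) ≃ₗ[F] (Fin n → F))
    (hf : ∀ K : Submodule F (Fin n → F), (∀ i, ¬ K ≤ coordHyperplane F n i) ↔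
      ∀ i, ¬ K.map (f : (Fin n → F) →ₗ[F] (Fin n → F)) ≤ coordHyperplane F n i) (k : ℕ) :
    IsInducedBy (topMap f hf k) f := fun T U hU =>
  ⟨codeMap f hf (k + 1) U, rfl, by rw [topMap_coe, hU, image_codesBelow]⟩

/-! ### Generator matrices and the orbit -/

/-- Applying a linear automorphism to the rows of a generator matrix gives a generator matrix of
the image. -/
theorem IsGeneratorMatrix.map {F : Type*} [Field F] {n m : ℕ} {M M' : Matrix (Fin m) (Fin n) F}
    {U : Submodule F (Fin n → F)} (hM : IsGeneratorMatrix M U)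
    (f : (Fin n → F) ≃ₗ[F] (Fin n → F)) (h : ∀ r, M'.row r = f (M.row r)) :
    IsGeneratorMatrix M' (U.map (f : (Fin n → F) →ₗ[F] (Fin n → F))) := by
  have hrow : M'.row = f ∘ M.row := funext h
  constructor
  · rw [hrow]
    exact hM.1.map' (f : (Fin n → F) →ₗ[F] (Fin n → F)) f.ker
  · rw [hrow, Set.range_comp, ← hM.2, Submodule.map_span]
    rfl

theorem mainTheorem6 (F : Type*) [Field F] [Finite F] (n k : ℕ) (hk : 2 ≤ k) (hkn : k + 3 ≤ n)
    (T : CodeTop F n k) (U : NondegCode F n (k + 1)) (hU : T.1 = codesBelow k U.1)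
    (M : Matrix (Fin (k + 1)) (Fin n) F) (hM : IsGeneratorMatrix M U.1) :
    MulAction.orbit (linearAutTops F n k) T =
      {T' : CodeTop F n k | ∃ (U' : NondegCode F n (k + 1)) (M' : Matrix (Fin (k + 1)) (Fin n) F),
        T'.1 = codesBelow k U'.1 ∧ IsGeneratorMatrix M' U'.1 ∧ SameColumns M M'} := by
  ext T'
  constructor
  · rintro ⟨⟨g, f, hg⟩, rfl⟩
    obtain ⟨δ, c, hc, hf⟩ := hg.monomial hk hkn
    obtain ⟨U', hU', hT'⟩ := hg T U hU
    refine ⟨U', Matrix.of fun r => f (M.row r), hT', ?_, δ, fun i => ⟨c i, hc i, ?_⟩⟩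
    · rw [hU']
      exact hM.map f fun r => rfl
    · ext r
      exact hf (M.row r) i
  · rintro ⟨U', M', hT', hM', δ, hδ⟩
    choose c hc hcol using hδ
    obtain ⟨f, hf⟩ := exists_monomial δ c hc
    have hnd := nondegenerate_map_iff hc hf
    refine ⟨⟨topMap f hnd k, f, topMap_isInducedBy f hnd k⟩, Subtype.ext ?_⟩
    -- Column proportionality, read row by row, says that `f` maps the rows of `M` to those of `M'`;
    -- hence `f(U) = U'`.
    have hgen := hM.map (M' := M') f fun r => by
      ext i
      rw [hf]
      exact congrFun (hcol i) r
    show codeMap f hnd k '' T.1 = T'.1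
    rw [hU, hT', image_codesBelow, codeMap_coe, ← hgen.2, hM'.2]
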